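/- Let $N\ge 1$, $\varepsilon=e^{2\pi i/N}$, and let $P_N=\begin{pmatrix}0_{1\times(N-1)}&1\\ I_{N-1}&0_{(N-1)\times1}\end{pmatrix}$. Let $W$ be a $\mathbb C^{N\times N}$-valued generalized Schur function, that is, $W$ is meromorphic in the open unit disk $\mathbb D$ and, for some integer $\kappa\ge 0$, the kernel $K_W(z,w)=\frac{I_N-W(z)W(w)^*}{1-z\overline w}$ has $\kappa$ negative squares in the domain of analyticity of $W$ in $\mathbb D$ (all Hermitian block matrices $(K_W(w_\ell,w_j))_{\ell,j=1}^M$ have at most $\kappa$ strictly negative eigenvalues, counted with multiplicity, and at least one of them has exactly $\kappa$). Let $\mathcal P$ be a Pontryagin space (a Krein space with finite-dimensional negative part), and let $A:\mathcal P\to\mathcal P$, $B:\mathbb C^N\to\mathcal P$, $C:\mathcal P\to\mathbb C^N$, $D:\mathbb C^N\to\mathbb C^N$ be bounded operators such that: (i) $W(z)=D+zC(I-zA)^{-1}B$ for $z$ in a neighborhood of the origin; (ii) the realization is coisometric: $M=\begin{pmatrix}A&B\\ C&D\end{pmatrix}$ satisfies $MM^{[*]}=I$, where $M^{[*]}$ is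 the adjoint with respect to the indefinite inner product of $\mathcal P\oplus\mathbb C^N$ ($\mathbb C^N$ with its standard inner product); (iii) the realization is closely outer connected: the linear span of the vectors $(I-zA^{[*]})^{-1}C^{[*]}\xi$, with $\xi\in\mathbb C^N$ and $z$ in a small disk around the origin, is dense in $\mathcal P$. Then $W(\varepsilon z)=W(z)P_N$ (as meromorphic functions in $\mathbb D$) if and only if there is a bounded and boundedly invertible operator $T:\mathcal P\to\mathcal P$ such that $$\begin{pmatrix}\varepsilon A&B\\ \varepsilon C&D\end{pmatrix}\begin{pmatrix}T&0\\0&I_N\end{pmatrix}=\begin{pmatrix}T&0\\0&I_N\end{pmatrix}\begin{pmatrix}A&B\\ C&D\end{pmatrix}\begin{pmatrix}I&0\\0&P_N\end{pmatrix}.$$ Moreover, every such $T$ satisfies $T^N=I$. -/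

import Mathlib

open Metric Filter Topology

noncomputable section

namespace SymmetricRealization

/-! ### Pontryagin spaces and adjoints -/

/-- A Pontryagin space together with a fundamental decomposition `P = P₊ [+] P₋`, `dim P₋ < ∞`.
The norm and the inner product of `P` are the (complete) natural ones `⟨v, w⟩ = [σ v, w]` of the
decomposition, where `σ (v₊ + v₋) = v₊ - v₋` is the fundamental symmetry; the Hermitian form of the
Pontryagin space is then `[v, w] = ⟨σ v, w⟩`, see `PontryaginStructure.form`, and `P₋` is the
kernel of `1 + σ`. All the choices of the decomposition give equivalent norms. -/
structure PontryaginStructure (P : Type*) [NormedAddCommGroup P] [InnerProductSpace ℂ P]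
    [CompleteSpace P] where
  /-- the fundamental symmetry -/
  σ : P →L[ℂ] P
  adjoint_σ : ContinuousLinearMap.adjoint σ = σ
  σ_comp_σ : σ ∘L σ = ContinuousLinearMap.id ℂ P
  finiteDimensional_neg :
    FiniteDimensional ℂ (LinearMap.ker ((ContinuousLinearMap.id ℂ P + σ : P →L[ℂ] P) : P →ₗ[ℂ] P))

section Pontryagin

variable {P : Type*} [NormedAddCommGroup P] [InnerProductSpace ℂ P] [CompleteSpace P]
variable {Q : Type*} [NormedAddCommGroup Q] [InnerProductSpace ℂ Q] [CompleteSpace Q]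

/-- The Hermitian form `[v, w]` of a Pontryagin space (linear in `w`, conjugate linear in `v`). -/
def PontryaginStructure.form (S : PontryaginStructure P) (v w : P) : ℂ := inner ℂ (S.σ v) w

/-- A Hilbert space is a Pontryagin space with the form `[v, w] = ⟨v, w⟩`. -/
def PontryaginStructure.hilbert (P : Type*) [NormedAddCommGroup P] [InnerProductSpace ℂ P]
    [CompleteSpace P] : PontryaginStructure P where
  σ := ContinuousLinearMap.id ℂ P
  adjoint_σ := ContinuousLinearMap.adjoint_id
  σ_comp_σ := rfl
  finiteDimensional_neg := by
    have h : LinearMap.ker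
        ((ContinuousLinearMap.id ℂ P + ContinuousLinearMap.id ℂ P : P →L[ℂ] P) : P →ₗ[ℂ] P)
          = ⊥ := by
      rw [LinearMap.ker_eq_bot']
      intro m hm
      have h2 : m + m = 0 := hm
      have h3 : (2 : ℂ) • m = 0 := by rw [two_smul, h2]
      exact (smul_eq_zero.mp h3).resolve_left two_ne_zero
    rw [h]
    infer_instance

/-- The adjoint `A^[*] = σ₁ A^* σ₂` of a bounded operator between Pontryagin spaces. -/
def pAdjoint (S : PontryaginStructure P) (R : PontryaginStructure Q) (A : P →L[ℂ] Q) :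
    Q →L[ℂ] P :=
  S.σ ∘L ContinuousLinearMap.adjoint A ∘L R.σ

/-- `A^[*]` is the adjoint with respect to the indefinite forms. -/
theorem form_pAdjoint (S : PontryaginStructure P) (R : PontryaginStructure Q) (A : P →L[ℂ] Q)
    (v : P) (w : Q) : R.form (A v) w = S.form v (pAdjoint S R A w) := by
  have hS : ∀ x y : P, inner ℂ (S.σ x) y = inner ℂ x (S.σ y) := fun x y => by
    rw [← ContinuousLinearMap.adjoint_inner_right, S.adjoint_σ]
  have hR : ∀ x y : Q, inner ℂ (R.σ x) y = inner ℂ x (R.σ y) := fun x y => by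
    rw [← ContinuousLinearMap.adjoint_inner_right, R.adjoint_σ]
  have hσ : ∀ x : P, S.σ (S.σ x) = x := fun x => congrArg (fun f => f x) S.σ_comp_σ
  simp only [PontryaginStructure.form, pAdjoint, ContinuousLinearMap.comp_apply]
  rw [hS v, hσ, hR, ContinuousLinearMap.adjoint_inner_right]

/-! ### Operator matrices and realizations -/

/-- The operator matrix `[[A, B], [C, D]]` acting on the orthogonal direct sum `P ⊕ Q`. -/
def blockOp (A : P →L[ℂ] P) (B : Q →L[ℂ] P) (C : P →L[ℂ] Q) (D : Q →L[ℂ] Q) :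
    WithLp 2 (P × Q) →L[ℂ] WithLp 2 (P × Q) :=
  ((WithLp.prodContinuousLinearEquiv 2 ℂ P Q).symm : P × Q →L[ℂ] WithLp 2 (P × Q)) ∘L
    ((A.coprod B).prod (C.coprod D)) ∘L
    ((WithLp.prodContinuousLinearEquiv 2 ℂ P Q) : WithLp 2 (P × Q) →L[ℂ] P × Q)

/-- `[[A, B], [C, D]] (x, y) = (A x + B y, C x + D y)`. -/
theorem blockOp_apply (A : P →L[ℂ] P) (B : Q →L[ℂ] P) (C : P →L[ℂ] Q) (D : Q →L[ℂ] Q)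
    (v : WithLp 2 (P × Q)) :
    blockOp A B C D v = WithLp.toLp 2 (A v.fst + B v.snd, C v.fst + D v.snd) := rfl

/-- The Pontryagin space `P ⊕ Q`, with the form `[(x, y), (x', y')] = [x, x'] + [y, y']`. -/
def PontryaginStructure.sum (S : PontryaginStructure P) (R : PontryaginStructure Q) :
    PontryaginStructure (WithLp 2 (P × Q)) where
  σ := blockOp S.σ 0 0 R.σ
  adjoint_σ := by
    symm
    rw [ContinuousLinearMap.eq_adjoint_iff]
    intro x y
    have hS : ∀ x y : P, inner ℂ (S.σ x) y = inner ℂ x (S.σ y) := fun x y => by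
      rw [← ContinuousLinearMap.adjoint_inner_right, S.adjoint_σ]
    have hR : ∀ x y : Q, inner ℂ (R.σ x) y = inner ℂ x (R.σ y) := fun x y => by
      rw [← ContinuousLinearMap.adjoint_inner_right, R.adjoint_σ]
    simp [blockOp_apply, WithLp.prod_inner_apply, hS, hR]
  σ_comp_σ := by
    have hS : ∀ x : P, S.σ (S.σ x) = x := fun x => congrArg (fun f => f x) S.σ_comp_σ
    have hR : ∀ x : Q, R.σ (R.σ x) = x := fun x => congrArg (fun f => f x) R.σ_comp_σ
    refine ContinuousLinearMap.ext fun x => ?_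
    simp only [ContinuousLinearMap.comp_apply, blockOp_apply, WithLp.toLp_fst, WithLp.toLp_snd,
      zero_apply, add_zero, zero_add, hS, hR]
    rfl
  finiteDimensional_neg := by
    have := S.finiteDimensional_neg
    have := R.finiteDimensional_neg
    set KS := LinearMap.ker
      ((ContinuousLinearMap.id ℂ P + S.σ : P →L[ℂ] P) : P →ₗ[ℂ] P) with hKS
    set KR := LinearMap.ker
      ((ContinuousLinearMap.id ℂ Q + R.σ : Q →L[ℂ] Q) : Q →ₗ[ℂ] Q) with hKR
    let K := LinearMap.ker ((ContinuousLinearMap.id ℂ (WithLp 2 (P × Q)) + blockOp S.σ 0 0 R.σ :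
      WithLp 2 (P × Q) →L[ℂ] WithLp 2 (P × Q)) : WithLp 2 (P × Q) →ₗ[ℂ] WithLp 2 (P × Q))
    have key : ∀ v : K, v.1.fst + S.σ v.1.fst = 0 ∧ v.1.snd + R.σ v.1.snd = 0 := by
      rintro ⟨v, hv⟩
      have h : v + blockOp S.σ 0 0 R.σ v = 0 := hv
      rw [blockOp_apply] at h
      constructor
      · simpa using congrArg (fun u : WithLp 2 (P × Q) => u.fst) h
      · simpa using congrArg (fun u : WithLp 2 (P × Q) => u.snd) h
    let f : K →ₗ[ℂ] KS × KR :=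
      { toFun := fun v => (⟨v.1.fst, (key v).1⟩, ⟨v.1.snd, (key v).2⟩)
        map_add' := fun _ _ => rfl
        map_smul' := fun _ _ => rfl }
    refine FiniteDimensional.of_injective f ?_
    intro v w hvw
    have h1 : v.1.fst = w.1.fst := congrArg (fun u : KS × KR => (u.1 : P)) hvw
    have h2 : v.1.snd = w.1.snd := congrArg (fun u : KS × KR => (u.2 : Q)) hvw
    apply Subtype.ext
    exact (WithLp.prodContinuousLinearEquiv 2 ℂ P Q).injective (Prod.ext h1 h2)

/-- `M` is coisometric: `M M^[*] = I`. -/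
def IsCoisometric (S : PontryaginStructure P) (M : P →L[ℂ] P) : Prop :=
  M ∘L pAdjoint S S M = ContinuousLinearMap.id ℂ P

/-- `(C, A)` is closely outer connected: the span of the vectors `(I - z A^[*])⁻¹ C^[*] ξ`, with `ξ`
in the outer space `Q` and `z` in a (small enough) disk around the origin, is dense in `P`. -/
def IsCloselyOuterConnected (S : PontryaginStructure P) (R : PontryaginStructure Q)
    (A : P →L[ℂ] P) (C : P →L[ℂ] Q) : Prop :=
  ∃ r : ℝ, 0 < r ∧
    (∀ z ∈ ball (0 : ℂ) r, IsUnit (1 - z • pAdjoint S S A)) ∧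
    Dense (Submodule.span ℂ {v : P | ∃ z ∈ ball (0 : ℂ) r, ∃ ξ : Q,
      v = Ring.inverse (1 - z • pAdjoint S S A) (pAdjoint S R C ξ)} : Set P)

end Pontryagin

/-- `ℂ^N` with its standard inner product. -/
abbrev Cvec (N : ℕ) : Type := EuclideanSpace ℂ (Fin N)

/-- A matrix as an operator on `ℂ^N`. -/
abbrev matOp {N : ℕ} (X : Matrix (Fin N) (Fin N) ℂ) : Cvec N →L[ℂ] Cvec N :=
  Matrix.toEuclideanCLM (n := Fin N) (𝕜 := ℂ) X

/-- `W(z) = D + z C (I - z A)⁻¹ B` for all `z` in a neighborhood of the origin. -/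
def IsRealization {N : ℕ} {P : Type*} [NormedAddCommGroup P] [InnerProductSpace ℂ P]
    (W : ℂ → Matrix (Fin N) (Fin N) ℂ) (A : P →L[ℂ] P) (B : Cvec N →L[ℂ] P)
    (C : P →L[ℂ] Cvec N) (D : Cvec N →L[ℂ] Cvec N) : Prop :=
  ∀ᶠ z in 𝓝 (0 : ℂ), IsUnit (1 - z • A) ∧
    matOp (W z) = D + z • (C ∘L Ring.inverse (1 - z • A) ∘L B)

/-! ### Generalized Schur functions -/

/-- The number of strictly negative eigenvalues, with multiplicity, of a Hermitian matrix. -/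
def negEigCount {n : Type*} [Fintype n] [DecidableEq n] {X : Matrix n n ℂ}
    (hX : X.IsHermitian) : ℕ :=
  (Finset.univ.filter fun i => hX.eigenvalues i < 0).card

/-- The block matrix with `(ℓ, j)` block entry `K (w ℓ) (w j)`. -/
def kernelMatrix {N : ℕ} (K : ℂ → ℂ → Matrix (Fin N) (Fin N) ℂ) {m : ℕ} (w : Fin m → ℂ) :
    Matrix (Fin m × Fin N) (Fin m × Fin N) ℂ :=
  Matrix.of fun a b => K (w a.1) (w b.1) a.2 b.2

/-- The kernel `K` is Hermitian and has `κ` negative squares on `Ω`. -/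
def HasNegativeSquares {N : ℕ} (κ : ℕ) (Ω : Set ℂ)
    (K : ℂ → ℂ → Matrix (Fin N) (Fin N) ℂ) : Prop :=
  (∀ z ∈ Ω, ∀ w ∈ Ω, (K z w).conjTranspose = K w z) ∧
  (∀ (m : ℕ) (w : Fin m → ℂ), (∀ i, w i ∈ Ω) →
    ∃ h : (kernelMatrix K w).IsHermitian, negEigCount h ≤ κ) ∧
  (∃ (m : ℕ) (w : Fin m → ℂ), (∀ i, w i ∈ Ω) ∧
    ∃ h : (kernelMatrix K w).IsHermitian, negEigCount h = κ)

/-- The kernel `K_W(z, w) = (I - W(z) W(w)^*) / (1 - z w^*)`. -/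
def schurKernel {N : ℕ} (W : ℂ → Matrix (Fin N) (Fin N) ℂ) (z w : ℂ) :
    Matrix (Fin N) (Fin N) ℂ :=
  (1 - z * star w)⁻¹ • (1 - W z * (W w).conjTranspose)

/-- The domain of analyticity of `W` in the open unit disk. -/
def analyticityDomain {N : ℕ} (W : ℂ → Matrix (Fin N) (Fin N) ℂ) : Set ℂ :=
  {z | z ∈ ball (0 : ℂ) 1 ∧ ∀ i j, AnalyticAt ℂ (fun u => W u i j) z}

/-- `W` is meromorphic in the open unit disk and its kernel `K_W` has `κ` negative squares in the
domain of analyticity of `W`. -/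
def IsGeneralizedSchur {N : ℕ} (κ : ℕ) (W : ℂ → Matrix (Fin N) (Fin N) ℂ) : Prop :=
  (∀ i j, MeromorphicOn (fun u => W u i j) (ball (0 : ℂ) 1)) ∧
  HasNegativeSquares κ (analyticityDomain W) (schurKernel W)

/-! ### The symmetry -/

/-- `ε = exp(2πi/N)`. -/
def eps (N : ℕ) : ℂ := Complex.exp (2 * Real.pi * Complex.I / N)

/-- The permutation matrix `P_N = [[0, 1], [I_{N-1}, 0]]`: its column `j` is the basis vector with
index `j + 1`, and its last column is the first basis vector. -/
def permMat (N : ℕ) : Matrix (Fin N) (Fin N) ℂ :=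
  Matrix.of fun i j => if i = finRotate N j then 1 else 0

/-- `W(εz) = W(z) P_N` as meromorphic functions in the open unit disk, that is, at all the points
`z` such that `W` is analytic at `z` and at `εz`. -/
def SatisfiesSymmetry {N : ℕ} (W : ℂ → Matrix (Fin N) (Fin N) ℂ) : Prop :=
  ∀ z ∈ analyticityDomain W, eps N * z ∈ analyticityDomain W →
    W (eps N * z) = W z * permMat N

/-- `T` satisfies
`[[εA, B], [εC, D]] [[T, 0], [0, I]] = [[T, 0], [0, I]] [[A, B], [C, D]] [[I, 0], [0, P_N]]`. -/
def Intertwines {N : ℕ} {P : Type*} [NormedAddCommGroup P] [InnerProductSpace ℂ P]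
    [CompleteSpace P] (A : P →L[ℂ] P) (B : Cvec N →L[ℂ] P) (C : P →L[ℂ] Cvec N)
    (D : Cvec N →L[ℂ] Cvec N) (T : P →L[ℂ] P) : Prop :=
  blockOp (eps N • A) B (eps N • C) D ∘L blockOp T 0 0 (ContinuousLinearMap.id ℂ (Cvec N)) =
    blockOp T 0 0 (ContinuousLinearMap.id ℂ (Cvec N)) ∘L blockOp A B C D ∘L
      blockOp (ContinuousLinearMap.id ℂ P) 0 0 (matOp (permMat N))

end SymmetricRealization

end

open Metric Filter Topology

noncomputable section

namespace SymmetricRealization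

open ContinuousLinearMap
open scoped InnerProductSpace

/-! ### Operator matrices -/

section blockOp

set_option linter.unusedSectionVars false

variable {P : Type*} [NormedAddCommGroup P] [InnerProductSpace ℂ P] [CompleteSpace P]
variable {Q : Type*} [NormedAddCommGroup Q] [InnerProductSpace ℂ Q] [CompleteSpace Q]


/-! Write `X n` for the Taylor coefficients of `W` at the origin. By the identity theorem the
symmetry says `ε ^ n X n = X n P_N` for all `n` (`satisfiesSymmetry_iff_taylorCoeff`), and an
intertwining `T` yields this at once.

Conversely, the relations force `C A ^ n T = ε⁻⁽ⁿ⁺¹⁾ C A ^ n`, so the Hilbert adjoint of `T` must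
have each vector `A*ⁿ C* ξ` as an eigenvector with eigenvalue `ε ^ (n + 1)`. These vectors are
total, by outer connectedness; the problem is to find a bounded operator with this action.
Coisometry expresses their indefinite Gram operators through the products `X n (X m)*`, and
unitarity of `P_N` then makes vectors with different eigenvalues orthogonal (`gram_smul_eq`). There
are at most `N` eigenvalues, so the closed eigenspans are finitely many, mutually orthogonal and
nondegenerate. In a Pontryagin space such subspaces have bounded orthogonal projections
(`exists_projection`), and the sum of eigenvalue times projection is the operator sought
(`exists_eigenOperator`).

Finally `C A ^ n T ^ N = C A ^ n` for all `n`, so observability gives `T ^ N = 1`, and with it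
invertibility. -/

theorem blockOp_comp (A A' : P →L[ℂ] P) (B B' : Q →L[ℂ] P) (C C' : P →L[ℂ] Q)
    (D D' : Q →L[ℂ] Q) :
    blockOp A B C D ∘L blockOp A' B' C' D' =
      blockOp (A ∘L A' + B ∘L C') (A ∘L B' + B ∘L D') (C ∘L A' + D ∘L C')
        (C ∘L B' + D ∘L D') := by
  refine ContinuousLinearMap.ext fun v => WithLp.ofLp_injective 2 (Prod.ext ?_ ?_) <;>
    simp [blockOp_apply, add_add_add_comm]

theorem blockOp_inj {A A' : P →L[ℂ] P} {B B' : Q →L[ℂ] P} {C C' : P →L[ℂ] Q}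
    {D D' : Q →L[ℂ] Q} :
    blockOp A B C D = blockOp A' B' C' D' ↔ A = A' ∧ B = B' ∧ C = C' ∧ D = D' := by
  refine ⟨fun h => ?_, by rintro ⟨rfl, rfl, rfl, rfl⟩; rfl⟩
  have key : ∀ x y, A x + B y = A' x + B' y ∧ C x + D y = C' x + D' y := fun x y => by
    have := congrArg (fun f => f (WithLp.toLp 2 (x, y))) h
    simpa [blockOp_apply] using this
  refine ⟨?_, ?_, ?_, ?_⟩ <;> ext1 x
  · simpa using (key x 0).1
  · simpa using (key 0 x).1
  · simpa using (key x 0).2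
  · simpa using (key 0 x).2

theorem blockOp_one :
    ContinuousLinearMap.id ℂ (WithLp 2 (P × Q)) =
      blockOp (ContinuousLinearMap.id ℂ P) 0 0 (ContinuousLinearMap.id ℂ Q) := by
  exact ContinuousLinearMap.ext fun v => WithLp.ofLp_injective 2 (Prod.ext (by simp [blockOp_apply])
    (by simp [blockOp_apply]))

end blockOp

/-! ### Pontryagin spaces -/

section Pontryagin

variable {P : Type*} [NormedAddCommGroup P] [InnerProductSpace ℂ P] [CompleteSpace P]
variable {Q : Type*} [NormedAddCommGroup Q] [InnerProductSpace ℂ Q] [CompleteSpace Q]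

/-- An injective perturbation of the identity by an operator of finite rank is surjective. -/
theorem surjective_id_sub_of_finiteDimensional_range {K V : Type*} [DivisionRing K]
    [AddCommGroup V] [Module K V] (F : V →ₗ[K] V) [FiniteDimensional K (LinearMap.range F)]
    (h : Function.Injective (LinearMap.id - F : V →ₗ[K] V)) :
    Function.Surjective (LinearMap.id - F : V →ₗ[K] V) := by
  have hmap : ∀ x ∈ LinearMap.range F, (LinearMap.id - F : V →ₗ[K] V) x ∈ LinearMap.range F := fun x hx =>
    Submodule.sub_mem _ hx ⟨x, rfl⟩
  have hinj : Function.Injective ((LinearMap.id - F : V →ₗ[K] V).restrict hmap) := fun x y hxy =>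
    Subtype.ext (h (congrArg Subtype.val hxy))
  intro y
  obtain ⟨u, hu⟩ := LinearMap.surjective_of_injective hinj ⟨F y, y, rfl⟩
  have hu' : u.1 - F u.1 = F y := congrArg Subtype.val hu
  -- With `u - F u = F y` solved inside the finite-dimensional range of `F`, the vector `y + u` is a
  -- preimage of `y`.
  exact ⟨y + u.1, by simp only [LinearMap.sub_apply, LinearMap.id_apply, map_add]; rw [← hu']; abel⟩

namespace PontryaginStructure

variable (S : PontryaginStructure P)

theorem σ_σ (x : P) : S.σ (S.σ x) = x := congrArg (fun f => f x) S.σ_comp_σ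

theorem inner_σ_left (x y : P) : ⟪S.σ x, y⟫_ℂ = ⟪x, S.σ y⟫_ℂ := by
  rw [← adjoint_inner_right, S.adjoint_σ]

theorem σ_injective : Function.Injective S.σ := Function.LeftInverse.injective S.σ_σ

/-- Since `(1 + σ)(1 - σ) = 1 - σ² = 0`, this range lies in the negative subspace. The finiteness of
the negative index enters the argument here. -/
theorem finiteDimensional_range_id_sub_σ :
    FiniteDimensional ℂ (LinearMap.range (LinearMap.id - (S.σ : P →ₗ[ℂ] P))) := by
  have := S.finiteDimensional_neg
  refine Submodule.finiteDimensional_of_le (S₂ := LinearMap.ker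
    ((ContinuousLinearMap.id ℂ P + S.σ : P →L[ℂ] P) : P →ₗ[ℂ] P)) ?_
  rintro _ ⟨x, rfl⟩
  simp [S.σ_σ]

/-- A closed nondegenerate subspace of a Pontryagin space is the range of a bounded projection
which is orthogonal with respect to the indefinite form. -/
theorem exists_projection (M : Submodule ℂ P) (hM : IsClosed (M : Set P))
    (hnd : ∀ x ∈ M, (∀ y ∈ M, ⟪S.σ x, y⟫_ℂ = 0) → x = 0) :
    ∃ E : P →L[ℂ] P, (∀ x ∈ M, E x = x) ∧
      ∀ x, (∀ y ∈ M, ⟪S.σ x, y⟫_ℂ = 0) → E x = 0 := by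
  have : CompleteSpace M := hM.completeSpace_coe
  set p : P →L[ℂ] M := M.orthogonalProjectionOnto
  -- `G` below is the Gram operator of the form on `M`: nondegeneracy is its injectivity, and `1 -
  -- G` has finite rank, so `G` is invertible and the projection is `G⁻¹ p σ`.
  have hp : ∀ x, p (S.σ x) = 0 ↔ ∀ y ∈ M, ⟪S.σ x, y⟫_ℂ = 0 := fun x => by
    rw [Submodule.orthogonalProjectionOnto_eq_zero_iff, Submodule.mem_orthogonal']
  set G : M →L[ℂ] M := p ∘L S.σ ∘L M.subtypeL
  have hG : ∀ x : M, G x = p (S.σ x) := fun _ => rfl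
  have hinj : Function.Injective G := by
    refine (injective_iff_map_eq_zero G).2 fun x hx => ?_
    exact Subtype.ext (hnd x x.2 ((hp x).1 hx))
  set F : M →ₗ[ℂ] M :=
    (p : P →ₗ[ℂ] M) ∘ₗ (LinearMap.id - (S.σ : P →ₗ[ℂ] P)) ∘ₗ M.subtype with hF
  have := S.finiteDimensional_range_id_sub_σ
  have hfin : FiniteDimensional ℂ (LinearMap.range F) := by
    refine Submodule.finiteDimensional_of_le (S₂ := (LinearMap.range
      (LinearMap.id - (S.σ : P →ₗ[ℂ] P))).map (p : P →ₗ[ℂ] M)) ?_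
    rintro _ ⟨x, rfl⟩
    exact ⟨_, ⟨x, rfl⟩, rfl⟩
  have hGF : (G : M →ₗ[ℂ] M) = LinearMap.id - F := by
    ext x
    simp [hG, hF, p]
  have hsurj : Function.Surjective G := by
    have h := surjective_id_sub_of_finiteDimensional_range F (by rw [← hGF]; exact hinj)
    rw [← hGF] at h
    exact h
  set G' := ContinuousLinearEquiv.ofBijective G (LinearMap.ker_eq_bot.2 hinj)
    (LinearMap.range_eq_top.2 hsurj)
  refine ⟨M.subtypeL ∘L (G'.symm : M →L[ℂ] M) ∘L p ∘L S.σ, fun x hx => ?_, fun x hx => ?_⟩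
  · have h : G'.symm (G ⟨x, hx⟩) = ⟨x, hx⟩ := G'.symm_apply_apply _
    exact congrArg Subtype.val h
  · have h : p (S.σ x) = 0 := (hp x).2 hx
    simp [h]

/-- A total family of vectors, such that any two of them with different eigenvalues are orthogonal
with respect to the form of the Pontryagin space and such that there are finitely many eigenvalues,
consists of eigenvectors of a bounded operator. -/
theorem exists_eigenOperator {ι : Type*} (v : ι → P) (c : ι → ℂ) (s : Finset ℂ)
    (hc : ∀ i, c i ∈ s) (htot : ∀ x : P, (∀ i, ⟪x, v i⟫_ℂ = 0) → x = 0)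
    (horth : ∀ i j, c i ≠ c j → ⟪S.σ (v i), v j⟫_ℂ = 0) :
    ∃ U : P →L[ℂ] P, ∀ i, U (v i) = c i • v i := by
  let M : ℂ → Submodule ℂ P := fun l =>
    (Submodule.span ℂ {x | ∃ i, c i = l ∧ x = v i}).topologicalClosure
  have hvM : ∀ i, v i ∈ M (c i) := fun i =>
    Submodule.le_topologicalClosure _ (Submodule.subset_span ⟨i, rfl, rfl⟩)
  have hle : ∀ (l : ℂ) (K : Submodule ℂ P), IsClosed (K : Set P) → (∀ i, c i = l → v i ∈ K) →
      M l ≤ K := fun l K hK h => by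
    refine Submodule.topologicalClosure_minimal _ (Submodule.span_le.2 ?_) hK
    rintro _ ⟨i, hi, rfl⟩
    exact h i hi
  have hperp : ∀ l i, c i ≠ l → ∀ y ∈ M l, ⟪S.σ (v i), y⟫_ℂ = 0 := fun l i hil y hy => by
    have := hle l (ℂ ∙ S.σ (v i))ᗮ (Submodule.isClosed_orthogonal _) (fun j hj =>
      Submodule.mem_orthogonal_singleton_iff_inner_right.2 (horth i j (hj ▸ hil))) hy
    exact Submodule.mem_orthogonal_singleton_iff_inner_right.1 this
  have hproj : ∀ l, ∃ E : P →L[ℂ] P, (∀ x ∈ M l, E x = x) ∧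
      ∀ x, (∀ y ∈ M l, ⟪S.σ x, y⟫_ℂ = 0) → E x = 0 := fun l => by
    -- Nondegeneracy: a vector of `M l` orthogonal to `M l` is also orthogonal to every `v i` with
    -- another eigenvalue, hence to a total family.
    refine S.exists_projection (M l) (Submodule.isClosed_topologicalClosure _) fun x hx h => ?_
    refine S.σ_injective ((htot (S.σ x) fun i => ?_).trans (map_zero _).symm)
    by_cases hi : c i = l
    · exact h _ (hi ▸ hvM i)
    · rw [S.inner_σ_left, ← inner_conj_symm, hperp l i hi x hx, map_zero]
  choose E hE hE' using hproj
  refine ⟨∑ l ∈ s, l • E l, fun i => ?_⟩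
  rw [sum_apply, Finset.sum_eq_single (c i)]
  · rw [smul_apply, hE _ _ (hvM i)]
  · intro l _ hl
    rw [smul_apply, hE' l _ (hperp l i hl.symm), smul_zero]
  · exact fun h => absurd (hc i) h

end PontryaginStructure

theorem adjoint_blockOp (A : P →L[ℂ] P) (B : Q →L[ℂ] P) (C : P →L[ℂ] Q) (D : Q →L[ℂ] Q) :
    adjoint (blockOp A B C D) = blockOp (adjoint A) (adjoint C) (adjoint B) (adjoint D) := by
  symm
  rw [eq_adjoint_iff]
  intro x y
  simp [blockOp_apply, WithLp.prod_inner_apply, inner_add_left, inner_add_right,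
    adjoint_inner_left]
  ring

/-- The relations `M M^[*] = I` for a coisometric operator matrix `M`, in terms of Hilbert space
adjoints. -/
theorem IsCoisometric.relations {S : PontryaginStructure P} {A : P →L[ℂ] P} {B : Q →L[ℂ] P}
    {C : P →L[ℂ] Q} {D : Q →L[ℂ] Q}
    (h : IsCoisometric (S.sum (PontryaginStructure.hilbert Q)) (blockOp A B C D)) :
    A ∘L S.σ ∘L adjoint A + B ∘L adjoint B = S.σ ∧
      A ∘L S.σ ∘L adjoint C + B ∘L adjoint D = 0 ∧
      C ∘L S.σ ∘L adjoint A + D ∘L adjoint B = 0 ∧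
      C ∘L S.σ ∘L adjoint C + D ∘L adjoint D = ContinuousLinearMap.id ℂ Q := by
  have hσ : (S.sum (PontryaginStructure.hilbert Q)).σ =
    blockOp S.σ 0 0 (ContinuousLinearMap.id ℂ Q) := rfl
  rw [IsCoisometric, pAdjoint, hσ, adjoint_blockOp, blockOp_comp, blockOp_comp, blockOp_comp,
    blockOp_one, blockOp_inj] at h
  simp only [zero_comp, comp_zero, add_zero, zero_add, comp_id, id_comp] at h
  obtain ⟨h1, h2, h3, h4⟩ := h
  refine ⟨?_, h2, ?_, h4⟩
  -- Composing with `σ` on the right cancels the outer `σ` of `A^[*] = σ A* σ`.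
  · have := congrArg (fun f => f ∘L S.σ) h1
    ext1 x
    simpa [S.σ_σ] using congrArg (fun f => f x) this
  · have := congrArg (fun f => f ∘L S.σ) h3
    ext1 x
    simpa [S.σ_σ] using congrArg (fun f => f x) this

end Pontryagin

/-! ### Power series of resolvents -/

/-- The Neumann series. -/
theorem eventually_hasSum_resolvent {R : Type*} [NormedRing R] [NormedAlgebra ℂ R]
    [CompleteSpace R] (a : R) :
    ∀ᶠ z in 𝓝 (0 : ℂ), HasSum (fun n => z ^ n • a ^ n) (Ring.inverse (1 - z • a)) := by
  have := (spectrum.hasFPowerSeriesOnBall_inverse_one_sub_smul ℂ a).hasFPowerSeriesAt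
  simpa [FormalMultilinearSeries.coeff] using hasFPowerSeriesAt_iff.1 this

theorem hasFPowerSeriesAt_of_eventually_hasSum {E : Type*} [NormedAddCommGroup E]
    [NormedSpace ℂ E] {X : ℕ → E} {f : ℂ → E}
    (h : ∀ᶠ z in 𝓝 (0 : ℂ), HasSum (fun n => z ^ n • X n) (f z)) :
    HasFPowerSeriesAt f (fun n => ContinuousMultilinearMap.mkPiRing ℂ (Fin n) (X n)) 0 := by
  exact hasFPowerSeriesAt_iff.2 (by simpa [FormalMultilinearSeries.coeff] using h)

theorem coeff_eq_of_eventually_hasSum {E : Type*} [NormedAddCommGroup E]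
    [NormedSpace ℂ E] {X Y : ℕ → E} {f : ℂ → E}
    (hX : ∀ᶠ z in 𝓝 (0 : ℂ), HasSum (fun n => z ^ n • X n) (f z))
    (hY : ∀ᶠ z in 𝓝 (0 : ℂ), HasSum (fun n => z ^ n • Y n) (f z)) (n : ℕ) : X n = Y n := by
  have h := (hasFPowerSeriesAt_of_eventually_hasSum hX).eq_formalMultilinearSeries
    (hasFPowerSeriesAt_of_eventually_hasSum hY)
  exact ContinuousMultilinearMap.mkPiRing_eq_iff.1 (congrFun h n)

theorem hasSum_comp_right {E F G : Type*} [NormedAddCommGroup E] [NormedSpace ℂ E]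
    [NormedAddCommGroup F] [NormedSpace ℂ F] [NormedAddCommGroup G] [NormedSpace ℂ G]
    {X : ℕ → F →L[ℂ] G} {Z : F →L[ℂ] G} (h : HasSum X Z) (Y : E →L[ℂ] F) :
    HasSum (fun n => X n ∘L Y) (Z ∘L Y) :=
  ((compL ℂ E F G).flip Y).hasSum h

/-! ### Observability from outer connectedness. -/

section Observability

variable {P : Type*} [NormedAddCommGroup P] [InnerProductSpace ℂ P] [CompleteSpace P]
variable {Q : Type*} [NormedAddCommGroup Q] [InnerProductSpace ℂ Q] [CompleteSpace Q]

theorem adjoint_pow (A : P →L[ℂ] P) (n : ℕ) : adjoint (A ^ n) = adjoint A ^ n := by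
  simpa only [star_eq_adjoint] using star_pow A n

/-- `A^[*]` is the conjugate of `A*` by the involution `σ`. -/
theorem pAdjoint_pow_apply (S : PontryaginStructure P) (A : P →L[ℂ] P) (n : ℕ) (x : P) :
    (pAdjoint S S A ^ n) (S.σ x) = S.σ (adjoint (A ^ n) x) := by
  rw [adjoint_pow]
  induction n with
  | zero => simp
  | succ n ih => simp only [pow_succ', mul_apply_eq_comp, ih]; simp [pAdjoint, S.σ_σ]

/-- A closely outer connected pair is observable. -/
theorem IsCloselyOuterConnected.eq_zero {S : PontryaginStructure P} {A : P →L[ℂ] P}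
    {C : P →L[ℂ] Q} (h : IsCloselyOuterConnected S (PontryaginStructure.hilbert Q) A C) {x : P}
    (hx : ∀ n, C ((A ^ n) x) = 0) : x = 0 := by
  obtain ⟨r, hr, hu, hd⟩ := h
  refine S.σ_injective ((hd.eq_zero_of_inner_left (𝕜 := ℂ) fun v hv => ?_).trans (map_zero _).symm)
  induction hv using Submodule.span_induction with
  | zero => simp
  | add u v _ _ h1 h2 => rw [inner_add_right, h1, h2, add_zero]
  | smul c u _ h1 => rw [inner_smul_right, h1, mul_zero]
  | mem v hv =>
    obtain ⟨z, hz, ξ, rfl⟩ := hv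
    set a := pAdjoint S S A
    let ev : (P →L[ℂ] P) →L[ℂ] ℂ :=
      innerSL ℂ (S.σ x) ∘L ContinuousLinearMap.apply ℂ P (S.σ (adjoint C ξ))
    have han : AnalyticOnNhd ℂ (fun z : ℂ => ev (Ring.inverse (1 - z • a))) (ball 0 r) := by
      refine DifferentiableOn.analyticOnNhd (fun z hz => ?_) isOpen_ball
      refine DifferentiableAt.differentiableWithinAt ?_
      have h1 : DifferentiableAt ℂ (fun z : ℂ => 1 - z • a) z := by fun_prop
      exact ev.differentiableAt.comp z
        (DifferentiableAt.comp (g := Ring.inverse) z (differentiableAt_inverse (𝕜 := ℂ) (hu z hz)) h1)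
    -- Up to the involution, this number is `⟪C Aⁿ x, ξ⟫`.
    have hev : ∀ n, ev (a ^ n) = 0 := fun n => by
      have : ev (a ^ n) = ⟪S.σ x, (a ^ n) (S.σ (adjoint C ξ))⟫_ℂ := rfl
      rw [this, pAdjoint_pow_apply, ← S.inner_σ_left, S.σ_σ, adjoint_inner_right,
        adjoint_inner_right, hx, inner_zero_left]
    have h0 : (fun z : ℂ => ev (Ring.inverse (1 - z • a))) =ᶠ[𝓝 0] 0 := by
      filter_upwards [eventually_hasSum_resolvent a] with z hz
      have := ev.hasSum hz
      simp only [map_smul, hev, smul_zero] at this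
      exact this.unique hasSum_zero
    -- The Neumann series is used only near `0`; the identity theorem carries the vanishing to the
    -- whole ball.
    exact han.eqOn_zero_of_preconnected_of_eventuallyEq_zero
      (convex_ball (0 : ℂ) r).isPreconnected (mem_ball_self hr) h0 hz

end Observability

/-! ### The symmetry in terms of Taylor coefficients -/

section Symmetry

variable {N : ℕ}

theorem eps_pow (hN : 1 ≤ N) : eps N ^ N = 1 :=
  (Complex.isPrimitiveRoot_exp N (by omega)).pow_eq_one

theorem norm_eps : ‖eps N‖ = 1 := by
  rw [eps, show (2 * Real.pi * Complex.I / N : ℂ) = ((2 * Real.pi / N : ℝ) : ℂ) * Complex.I by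
    push_cast; ring, Complex.norm_exp_ofReal_mul_I]

theorem conj_eps_mul : (starRingEnd ℂ) (eps N) * eps N = 1 := by
  rw [← Complex.normSq_eq_conj_mul_self, Complex.normSq_eq_norm_sq, norm_eps]
  simp

theorem matOp_mul (X Y : Matrix (Fin N) (Fin N) ℂ) : matOp (X * Y) = matOp X ∘L matOp Y :=
  map_mul _ X Y

theorem permMat_mul_conjTranspose : permMat N * (permMat N).conjTranspose = 1 := by
  ext i j
  simp only [Matrix.mul_apply, Matrix.conjTranspose_apply, permMat, Matrix.of_apply,
    Matrix.one_apply]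
  rw [Finset.sum_eq_single ((finRotate N).symm i)]
  · rw [Equiv.apply_symm_apply]; simp [eq_comm]
  · intro k _ hk
    rw [if_neg fun h => hk (by rw [h, Equiv.symm_apply_apply]), zero_mul]
  · simp

variable {P : Type*} [NormedAddCommGroup P] [InnerProductSpace ℂ P]

/-- The Taylor coefficients at the origin of `D + z C (1 - z A)⁻¹ B`. -/
def taylorCoeff (A : P →L[ℂ] P) (B : Cvec N →L[ℂ] P) (C : P →L[ℂ] Cvec N)
    (D : Cvec N →L[ℂ] Cvec N) : ℕ → Cvec N →L[ℂ] Cvec N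
  | 0 => D
  | n + 1 => C ∘L (A ^ n) ∘L B

variable [CompleteSpace P] {W : ℂ → Matrix (Fin N) (Fin N) ℂ} {A : P →L[ℂ] P}
  {B : Cvec N →L[ℂ] P} {C : P →L[ℂ] Cvec N} {D : Cvec N →L[ℂ] Cvec N}

theorem IsRealization.hasSum (h : IsRealization W A B C D) :
    ∀ᶠ z in 𝓝 (0 : ℂ), HasSum (fun n => z ^ n • taylorCoeff A B C D n) (matOp (W z)) := by
  filter_upwards [h, eventually_hasSum_resolvent A] with z hz hs
  -- The constant term `D` is split off; the tail is `z` times the Neumann series sandwiched between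
  -- `C` and `B`.
  rw [hz.2, ← hasSum_nat_add_iff' 1]
  let L : (P →L[ℂ] P) →L[ℂ] (Cvec N →L[ℂ] Cvec N) :=
    (compL ℂ (Cvec N) P (Cvec N) C) ∘L ((compL ℂ (Cvec N) P P).flip B)
  have := (L.hasSum hs).const_smul z
  simp only [L, map_smul, comp_apply, flip_apply, compL_apply] at this
  simpa [taylorCoeff, pow_succ', mul_smul] using this

theorem IsRealization.analyticAt (h : IsRealization W A B C D) (i j : Fin N) :
    AnalyticAt ℂ (fun u => W u i j) 0 := by
  have h1 := (hasFPowerSeriesAt_of_eventually_hasSum h.hasSum).analyticAt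
  let L : (Cvec N →L[ℂ] Cvec N) →L[ℂ] ℂ :=
    EuclideanSpace.proj i ∘L ContinuousLinearMap.apply ℂ (Cvec N) (EuclideanSpace.single j 1)
  have h2 : AnalyticAt ℂ (fun u => L (matOp (W u))) 0 := (L.analyticAt _).comp h1
  refine h2.congr (Eventually.of_forall fun u => ?_)
  simp [L, Matrix.ofLp_toEuclideanCLM]

theorem eventually_mem_analyticityDomain (h : IsRealization W A B C D) :
    ∀ᶠ z in 𝓝 (0 : ℂ), z ∈ analyticityDomain W :=
  Filter.Eventually.and (ball_mem_nhds (0 : ℂ) one_pos)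
    (eventually_all.2 fun i => eventually_all.2 fun j => (h.analyticAt i j).eventually_analyticAt)

theorem tendsto_eps_mul : Tendsto (fun z => eps N * z) (𝓝 0) (𝓝 0) := by
  have h : Continuous fun z => eps N * z := by fun_prop
  simpa using h.tendsto 0

/-- By the identity theorem, the symmetry `W(εz) = W(z) P_N` is a local property at the origin. -/
theorem satisfiesSymmetry_iff_eventually
    (hW : ∀ i j, MeromorphicOn (fun u => W u i j) (ball (0 : ℂ) 1))
    (h : IsRealization W A B C D) :
    SatisfiesSymmetry W ↔ ∀ᶠ z in 𝓝 (0 : ℂ), W (eps N * z) = W z * permMat N := by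
  refine ⟨fun hs => ?_, fun hs z hz hz' => ?_⟩
  · filter_upwards [eventually_mem_analyticityDomain h,
      tendsto_eps_mul.eventually (eventually_mem_analyticityDomain h)] with z using hs z
  · ext i j
    have hball : ∀ u ∈ ball (0 : ℂ) 1, eps N * u ∈ ball (0 : ℂ) 1 := fun u hu => by
      simpa [norm_eps] using hu
    set f : ℂ → ℂ := fun u => W (eps N * u) i j - ∑ k, W u i k * permMat N k j with hf
    have hmer : MeromorphicOn f (ball 0 1) := fun u hu => by
      refine MeromorphicAt.sub ?_ ?_
      · exact (hW i j _ (hball u hu)).comp_analyticAt (g := fun u => eps N * u) (by fun_prop)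
      · exact MeromorphicAt.fun_sum fun k _ => (hW i k u hu).mul (MeromorphicAt.const _ _)
    have hanal : AnalyticAt ℂ f z := by
      refine AnalyticAt.sub ?_ ?_
      · exact (hz'.2 i j).comp (g := fun u => W u i j) (f := fun u => eps N * u) (by fun_prop)
      · exact Finset.analyticAt_fun_sum _ fun k _ => (hz.2 i k).mul analyticAt_const
    have h0 : meromorphicOrderAt f 0 = ⊤ := by
      rw [meromorphicOrderAt_eq_top_iff]
      refine Filter.Eventually.filter_mono nhdsWithin_le_nhds ?_
      filter_upwards [hs] with u hu
      rw [hf]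
      simp only [hu, Matrix.mul_apply, sub_self]
    -- Infinite order propagates through the connected disk, so `f` vanishes on a punctured
    -- neighborhood of `z`; continuity then gives the value at `z` itself.
    have hz0 : meromorphicOrderAt f z = ⊤ := by
      by_contra hne
      exact hmer.meromorphicOrderAt_ne_top_of_isPreconnected
        (convex_ball (0 : ℂ) 1).isPreconnected hz.1 (mem_ball_self one_pos) hne h0
    rw [meromorphicOrderAt_eq_top_iff] at hz0
    have := tendsto_nhds_unique (hanal.continuousAt.tendsto.mono_left nhdsWithin_le_nhds)
      (tendsto_const_nhds.congr' (hz0.mono fun u hu => hu.symm))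
    rw [Matrix.mul_apply]
    exact sub_eq_zero.1 this

theorem satisfiesSymmetry_iff_taylorCoeff
    (hW : ∀ i j, MeromorphicOn (fun u => W u i j) (ball (0 : ℂ) 1))
    (h : IsRealization W A B C D) :
    SatisfiesSymmetry W ↔ ∀ n, eps N ^ n • taylorCoeff A B C D n =
      taylorCoeff A B C D n ∘L matOp (permMat N) := by
  have h1 : ∀ᶠ z in 𝓝 (0 : ℂ), HasSum (fun n => z ^ n • eps N ^ n • taylorCoeff A B C D n)
      (matOp (W (eps N * z))) := by
    filter_upwards [tendsto_eps_mul.eventually h.hasSum] with z hz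
    convert hz using 2 with n
    rw [smul_smul, mul_pow, mul_comm]
  have h2 : ∀ᶠ z in 𝓝 (0 : ℂ), HasSum
      (fun n => z ^ n • (taylorCoeff A B C D n ∘L matOp (permMat N)))
      (matOp (W z * permMat N)) := by
    filter_upwards [h.hasSum] with z hz
    rw [matOp_mul]
    simpa only [smul_comp] using hasSum_comp_right hz (matOp (permMat N))
  rw [satisfiesSymmetry_iff_eventually hW h]
  refine ⟨fun hs n => ?_, fun hs => ?_⟩
  · have h3 : ∀ᶠ z in 𝓝 (0 : ℂ), HasSum
        (fun n => z ^ n • (taylorCoeff A B C D n ∘L matOp (permMat N)))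
        (matOp (W (eps N * z))) := by
      filter_upwards [h2, hs] with z hz h
      rwa [h]
    exact coeff_eq_of_eventually_hasSum h1 h3 n
  · filter_upwards [h1, h2] with z hz1 hz2
    simp only [hs] at hz1
    exact (Matrix.toEuclideanCLM (n := Fin N) (𝕜 := ℂ)).injective (hz1.unique hz2)

end Symmetry

/-! ### Intertwining operators -/

section Intertwining

variable {N : ℕ} {P : Type*} [NormedAddCommGroup P] [InnerProductSpace ℂ P] [CompleteSpace P]
  {A : P →L[ℂ] P} {B : Cvec N →L[ℂ] P} {C : P →L[ℂ] Cvec N} {D : Cvec N →L[ℂ] Cvec N}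
  {T : P →L[ℂ] P}

theorem intertwines_iff : Intertwines A B C D T ↔
    eps N • (A ∘L T) = T ∘L A ∧ B = T ∘L B ∘L matOp (permMat N) ∧ eps N • (C ∘L T) = C ∧
      D = D ∘L matOp (permMat N) := by
  rw [Intertwines, blockOp_comp, blockOp_comp, blockOp_comp, blockOp_inj]
  simp

/-- Moving `T` through `A ^ n` costs `ε ^ n`, and absorbing it into `C` costs one more `ε`; hence
the exponent `n + 1`. -/
theorem Intertwines.pow_smul_comp (h : Intertwines A B C D T) (n : ℕ) :
    eps N ^ (n + 1) • (C ∘L (A ^ n) ∘L T) = C ∘L (A ^ n) := by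
  obtain ⟨hA, -, hC, -⟩ := intertwines_iff.1 h
  have hA' : ∀ x, T (A x) = eps N • A (T x) := fun x => (congrArg (fun f => f x) hA).symm
  have hC' : ∀ x, eps N • C (T x) = C x := fun x => congrArg (fun f => f x) hC
  have key : ∀ x, T ((A ^ n) x) = eps N ^ n • (A ^ n) (T x) := by
    induction n with
    | zero => simp
    | succ n ih => intro x; simp only [pow_succ', mul_apply_eq_comp, hA', ih, map_smul, smul_smul]
  ext1 x
  have := hC' ((A ^ n) x)
  rw [key, map_smul, smul_smul, ← pow_succ'] at this
  exact this

/-- Each `C A ^ n` is an eigenvector of right composition with `T`, with an `N`-th root of unity as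
eigenvalue, and these operators jointly separate points. -/
theorem Intertwines.pow_eq_one (hN : 1 ≤ N) (h : Intertwines A B C D T)
    (hobs : ∀ x, (∀ n, C ((A ^ n) x) = 0) → x = 0) : T ^ N = 1 := by
  have key : ∀ n k x, (eps N ^ (n + 1)) ^ k • C ((A ^ n) ((T ^ k) x)) = C ((A ^ n) x) := by
    intro n k
    induction k with
    | zero => simp
    | succ k ih =>
      intro x
      have := congrArg (fun f => f ((T ^ k) x)) (h.pow_smul_comp n)
      rw [← ih x, pow_succ, pow_succ' T, mul_smul]
      exact congrArg _ this
  ext1 x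
  refine sub_eq_zero.1 (hobs _ fun n => ?_)
  have := key n N x
  rw [← pow_mul, mul_comm, pow_mul, eps_pow hN, one_pow, one_smul] at this
  rw [map_sub, map_sub, this, one_apply_eq_self, sub_self]

theorem Intertwines.smul_taylorCoeff (h : Intertwines A B C D T) (n : ℕ) :
    eps N ^ n • taylorCoeff A B C D n = taylorCoeff A B C D n ∘L matOp (permMat N) := by
  obtain ⟨-, hB, -, hD⟩ := intertwines_iff.1 h
  cases n with
  | zero => rw [pow_zero, one_smul]; exact hD
  | succ n =>
    ext1 x
    have h1 := congrArg (fun f => f (B (matOp (permMat N) x))) (h.pow_smul_comp n)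
    have h2 : B x = T (B (matOp (permMat N) x)) := congrArg (fun f => f x) hB
    simp only [taylorCoeff, smul_apply, comp_apply] at h1 ⊢
    rw [← h1, h2]

/-- Products of Taylor coefficients respect the symmetry, since the permutation matrix is unitary. -/
theorem smul_comp_adjoint_of_symmetry {X Y : Cvec N →L[ℂ] Cvec N} {n m : ℕ}
    (hX : eps N ^ n • X = X ∘L matOp (permMat N))
    (hY : eps N ^ m • Y = Y ∘L matOp (permMat N)) :
    eps N ^ n • (X ∘L adjoint Y) = eps N ^ m • (X ∘L adjoint Y) := by
  have hP : matOp (permMat N) ∘L adjoint (matOp (permMat N)) = ContinuousLinearMap.id ℂ _ := by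
    have h1 : adjoint (matOp (permMat N)) = matOp (permMat N).conjTranspose :=
      (map_star (Matrix.toEuclideanCLM (n := Fin N) (𝕜 := ℂ)) (permMat N)).symm
    rw [h1, ← matOp_mul, permMat_mul_conjTranspose]
    exact map_one (Matrix.toEuclideanCLM (n := Fin N) (𝕜 := ℂ))
  -- The left side is `X P_N P_N* Y*` by the symmetry, and `ε ^ n` times the conjugate of `ε ^ m`
  -- times `X Y*` by expansion.
  have h2 : (eps N ^ n • X) ∘L adjoint (eps N ^ m • Y) = X ∘L adjoint Y := by
    rw [hX, hY, adjoint_comp, comp_assoc, ← comp_assoc (matOp (permMat N)), hP, id_comp]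
  have h3 : (starRingEnd ℂ) (eps N) ^ m * eps N ^ m = 1 := by
    rw [← mul_pow, conj_eps_mul, one_pow]
  rw [map_smulₛₗ, smul_comp, comp_smul, map_pow] at h2
  conv_rhs => rw [← h2]
  rw [smul_smul, smul_smul, mul_right_comm, mul_comm (_ * _), mul_comm (eps N ^ m), h3, mul_one]

variable {S : PontryaginStructure P}

/-- The Gram operators of the vectors `A^*ⁿ C^* ξ` with respect to the indefinite form respect the
symmetry. -/
theorem gram_smul_eq
    (hM : IsCoisometric (S.sum (PontryaginStructure.hilbert (Cvec N))) (blockOp A B C D))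
    (hsym : ∀ n, eps N ^ n • taylorCoeff A B C D n =
      taylorCoeff A B C D n ∘L matOp (permMat N)) (n m : ℕ) (ξ : Cvec N) :
    eps N ^ n • C ((A ^ n) (S.σ (adjoint (A ^ m) (adjoint C ξ)))) =
      eps N ^ m • C ((A ^ n) (S.σ (adjoint (A ^ m) (adjoint C ξ)))) := by
  obtain ⟨h1, h2, h3, -⟩ := hM.relations
  have r1 : ∀ x, A (S.σ (adjoint A x)) = S.σ x - B (adjoint B x) := fun x =>
    eq_sub_of_add_eq (congrArg (fun f => f x) h1)
  have r2 : ∀ x, A (S.σ (adjoint C x)) = -B (adjoint D x) := fun x =>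
    eq_neg_of_add_eq_zero_left (congrArg (fun f => f x) h2)
  have r3 : ∀ x, C (S.σ (adjoint A x)) = -D (adjoint B x) := fun x =>
    eq_neg_of_add_eq_zero_left (congrArg (fun f => f x) h3)
  have hX : ∀ n m, eps N ^ n • taylorCoeff A B C D n (adjoint (taylorCoeff A B C D m) ξ) =
      eps N ^ m • taylorCoeff A B C D n (adjoint (taylorCoeff A B C D m) ξ) := fun n m =>
    congrArg (fun f => f ξ) (smul_comp_adjoint_of_symmetry (hsym n) (hsym m))
  have hadj : ∀ m x, adjoint (A ^ (m + 1)) x = adjoint A (adjoint (A ^ m) x) := fun m x => by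
    rw [adjoint_pow, adjoint_pow, pow_succ', mul_apply_eq_comp]
  have hX0 : ∀ x, adjoint (taylorCoeff A B C D 0) x = adjoint D x :=
    fun _ => rfl
  have hXs : ∀ m x, adjoint (taylorCoeff A B C D (m + 1)) x =
      adjoint B (adjoint (A ^ m) (adjoint C x)) := fun m x => by
    simp only [taylorCoeff, adjoint_comp, comp_apply]
  -- With `G n m = C Aⁿ σ A*ᵐ C*`, coisometry gives `G (n+1) (m+1) = G n m - X (n+1) (X (m+1))*`,
  -- while `G 0 (m+1)` and `G (n+1) 0` are `-X 0 (X (m+1))*` and `-X (n+1) (X 0)*`. For `G 0 0` both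
  -- factors are `1`.
  induction n generalizing m with
  | zero =>
    cases m with
    | zero => rfl
    | succ m =>
      have := hX 0 (m + 1)
      rw [hXs] at this
      rw [hadj, pow_zero A, one_apply_eq_self, r3, smul_neg, smul_neg]
      exact congrArg _ this
  | succ n ih =>
    rw [pow_succ A, mul_apply_eq_comp]
    cases m with
    | zero =>
      have := hX (n + 1) 0
      rw [hX0] at this
      rw [pow_zero A, adjoint_one, one_apply_eq_self, r2, map_neg, map_neg, smul_neg, smul_neg]
      exact congrArg _ this
    | succ m =>
      have := hX (n + 1) (m + 1)
      rw [hXs] at this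
      rw [hadj, r1, map_sub, map_sub, smul_sub, smul_sub, pow_succ', pow_succ' _ m, mul_smul,
        mul_smul, ih m, ← mul_smul, ← mul_smul, ← pow_succ', ← pow_succ']
      exact congrArg _ this

/-- A coisometric, closely outer connected realization of a symmetric function admits an
intertwining operator. -/
theorem exists_intertwines (hN : 1 ≤ N)
    (hM : IsCoisometric (S.sum (PontryaginStructure.hilbert (Cvec N))) (blockOp A B C D))
    (hobs : ∀ x, (∀ n, C ((A ^ n) x) = 0) → x = 0)
    (hsym : ∀ n, eps N ^ n • taylorCoeff A B C D n =
      taylorCoeff A B C D n ∘L matOp (permMat N)) :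
    ∃ T : P →L[ℂ] P, Intertwines A B C D T := by
  obtain ⟨U, hU⟩ := S.exists_eigenOperator
    (fun i : ℕ × Cvec N => adjoint (A ^ i.1) (adjoint C i.2)) (fun i => eps N ^ (i.1 + 1))
    (Polynomial.nthRootsFinset N (1 : ℂ))
    (fun i => by
      rw [Polynomial.mem_nthRootsFinset (by omega), ← pow_mul, mul_comm, pow_mul, eps_pow hN,
        one_pow])
    (fun x hx => hobs x fun n => by
      refine ext_inner_right ℂ fun ξ => ?_
      have := hx (n, ξ)
      rwa [adjoint_inner_right, adjoint_inner_right, ← inner_zero_left (𝕜 := ℂ) ξ] at this)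
    (fun i j hij => by
      rw [adjoint_inner_right, adjoint_inner_right]
      by_cases h : eps N ^ j.1 = eps N ^ i.1
      · exact absurd (by rw [pow_succ, pow_succ, h]) hij
      -- The Gram vector is annihilated by `ε ^ j - ε ^ i ≠ 0`, so it vanishes.
      · have := sub_eq_zero.2 (gram_smul_eq hM hsym j.1 i.1 i.2)
        rw [← sub_smul] at this
        rw [(smul_eq_zero.1 this).resolve_left (sub_ne_zero.2 h), inner_zero_left])
  have he : ∀ n, (starRingEnd ℂ) (eps N) ^ n * eps N ^ n = 1 := fun n => by
    rw [← mul_pow, conj_eps_mul, one_pow]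
  have key : ∀ n x, C ((A ^ n) (adjoint U x)) =
      (starRingEnd ℂ) (eps N) ^ (n + 1) • C ((A ^ n) x) := fun n x => by
    refine ext_inner_right ℂ fun ξ => ?_
    have := hU (n, ξ)
    rw [← adjoint_inner_right, ← adjoint_inner_right, adjoint_inner_left, this, inner_smul_right,
      inner_smul_left, ← adjoint_inner_right, ← adjoint_inner_right, map_pow (starRingEnd ℂ), Complex.conj_conj]
  have hext : ∀ x y, (∀ n, C ((A ^ n) x) = C ((A ^ n) y)) → x = y := fun x y h =>
    sub_eq_zero.1 (hobs _ fun n => by rw [map_sub, map_sub, h, sub_self])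
  -- `key` determines `T = U*` after every `C A ^ n`, so by `hext` the relations involving `A` and
  -- `B` need only be compared there.
  refine ⟨adjoint U, intertwines_iff.2 ⟨?_, ?_, ?_, ?_⟩⟩
  · ext1 x
    refine hext _ _ fun n => ?_
    simp only [smul_apply, comp_apply, map_smul, key]
    rw [← mul_apply_eq_comp, ← pow_succ, key, smul_smul, pow_succ _ (n + 1), mul_left_comm,
      mul_comm (eps N), conj_eps_mul, mul_one, pow_succ A, mul_apply_eq_comp]
  · ext1 x
    refine hext _ _ fun n => ?_
    have h : eps N ^ (n + 1) • C ((A ^ n) (B x)) = C ((A ^ n) (B (matOp (permMat N) x))) :=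
      congrArg (fun f => f x) (hsym (n + 1))
    simp only [comp_apply]
    rw [key, ← h, smul_smul, he, one_smul]
  · ext1 x
    have := key 0 x
    simp only [pow_zero, one_apply_eq_self, zero_add, pow_one] at this
    rw [smul_apply, comp_apply, this, smul_smul, mul_comm, conj_eps_mul, one_smul]
  · have := hsym 0
    rwa [pow_zero, one_smul] at this

end Intertwining

end SymmetricRealization

end

theorem mainTheorem9 {N : ℕ} (hN : 1 ≤ N) {κ : ℕ} (W : ℂ → Matrix (Fin N) (Fin N) ℂ)
    (hW : SymmetricRealization.IsGeneralizedSchur κ W)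
    {P : Type*} [NormedAddCommGroup P] [InnerProductSpace ℂ P] [CompleteSpace P]
    (S : SymmetricRealization.PontryaginStructure P)
    (A : P →L[ℂ] P) (B : SymmetricRealization.Cvec N →L[ℂ] P)
    (C : P →L[ℂ] SymmetricRealization.Cvec N)
    (D : SymmetricRealization.Cvec N →L[ℂ] SymmetricRealization.Cvec N)
    (hreal : SymmetricRealization.IsRealization W A B C D)
    (hcoiso : SymmetricRealization.IsCoisometric
      (S.sum (SymmetricRealization.PontryaginStructure.hilbert (SymmetricRealization.Cvec N)))
      (SymmetricRealization.blockOp A B C D))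
    (houter : SymmetricRealization.IsCloselyOuterConnected S
      (SymmetricRealization.PontryaginStructure.hilbert (SymmetricRealization.Cvec N)) A C) :
    (SymmetricRealization.SatisfiesSymmetry W ↔
      ∃ T : P ≃L[ℂ] P, SymmetricRealization.Intertwines A B C D (T : P →L[ℂ] P)) ∧
    (∀ T : P ≃L[ℂ] P, SymmetricRealization.Intertwines A B C D (T : P →L[ℂ] P) →
      (T : P →L[ℂ] P) ^ N = 1) := by
  have hobs : ∀ x, (∀ n, C ((A ^ n) x) = 0) → x = 0 := fun x hx => houter.eq_zero hx
  refine ⟨?_, fun T hT => hT.pow_eq_one hN hobs⟩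
  rw [SymmetricRealization.satisfiesSymmetry_iff_taylorCoeff hW.1 hreal]
  refine ⟨fun hsym => ?_, fun ⟨T, hT⟩ => hT.smul_taylorCoeff⟩
  obtain ⟨T, hT⟩ := SymmetricRealization.exists_intertwines hN hcoiso hobs hsym
  -- Invertibility comes from `T ^ N = 1`, with inverse `T ^ (N - 1)`.
  have hTN : T ^ (N - 1) * T = 1 := by
    rw [← pow_succ, Nat.sub_add_cancel hN, hT.pow_eq_one hN hobs]
  have hTN' : T * T ^ (N - 1) = 1 := by
    rw [← pow_succ', Nat.sub_add_cancel hN, hT.pow_eq_one hN hobs]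
  refine ⟨ContinuousLinearEquiv.equivOfInverse T (T ^ (N - 1))
    (fun x => congrArg (fun f => f x) hTN) (fun x => congrArg (fun f => f x) hTN'), ?_⟩
  exact hT
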